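/- Let $Q$ be a smooth Banach manifold modelled on a Banach space $\mathbf{E}$, with a smooth weak Riemannian metric $\langle\cdot,\cdot\rangle$ (a smooth field of continuous symmetric positive definite bilinear forms on the tangent spaces). Assume that 1. $Q$ has a smooth Riemannian (i.e. torsion free and metric) connection, with Christoffel maps $\Gamma$ in charts; 2. for every $\eta\in Q$ the inclusion $T_\eta Q\to T_\eta^*Q$, $v\mapsto\langle v,\cdot\rangle_\eta$, has dense range. Let $\tau:TQ\to Q$ be the projection and let $K:TTQ\to TQ$ be the connector, $K(\eta,v,u,w)=(\eta,w+\Gamma(\eta)(v,u))$ in charts. For $V\in T_\eta Q$ let $\Theta_V=(T\tau,K):T_V TQ\to T_\eta Q\oplus T_\eta Q$, which is an isomorphism. For $f:TQ\to\mathbb{R}$ the covariant partial derivatives are the covectors on $T_\eta Q$ $$\frac{\partial f}{\partial\eta}(V)\cdot W=df\cdot\Theta_V^{-1}(W,0),\qquad \frac{\partial f}{\partial v}(V)\cdot W=df\cdot\Theta_V^{-1}(0,W),\qquad W\in T_\eta Q.$$ When such a covector has the form $\langle Z,\cdot\rangle_\eta$ with $Z\in T_\eta Q$, it is identified with the (unique)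 vector $Z$. For $k\in\{0,1,2,\dots\}\cup\{\infty\}$ let $\mathcal{K}^k$ be the set of all $f\in C^{k+1}(TQ,\mathbb{R})$ such that $\frac{\partial f}{\partial\eta}(V)$ and $\frac{\partial f}{\partial v}(V)$ are represented by vectors for every $V\in TQ$ and the resulting fibre preserving maps $\frac{\partial f}{\partial\eta},\frac{\partial f}{\partial v}:TQ\to TQ$ are of class $C^k$; let $\mathcal{K}=\mathcal{K}^\infty$. Define $$\{f,g\}=\Big\langle\frac{\partial f}{\partial\eta},\frac{\partial g}{\partial v}\Big\rangle-\Big\langle\frac{\partial f}{\partial v},\frac{\partial g}{\partial\eta}\Big\rangle .$$ Then the bracket maps $\mathcal{K}^k\times\mathcal{K}^m$ into $\mathcal{K}^{\min(k,m)-1}$ for all integers $k,m\ge1$, and it maps $\mathcal{K}\times\mathcal{K}$ into $\mathcal{K}$. Moreover, for $f,g\in\mathcal{K}^1$, $h=\{f,g\}$ and every $V\in TQ$, the covariant partials of $h$ are represented by the vectors $$\frac{\partial h}{\partial\eta}(V)=K\frac{\partial}{\partial\eta}\frac{\partial f}{\partial\eta}\cdot\frac{\partial g}{\partial v}+K\frac{\partial}{\partial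 v}\frac{\partial g}{\partial\eta}\cdot\frac{\partial f}{\partial\eta}-K\frac{\partial}{\partial\eta}\frac{\partial g}{\partial\eta}\cdot\frac{\partial f}{\partial v}-K\frac{\partial}{\partial v}\frac{\partial f}{\partial\eta}\cdot\frac{\partial g}{\partial\eta}+\mathcal{R}\Big(\frac{\partial f}{\partial v},\frac{\partial g}{\partial v}\Big)V,$$ $$\frac{\partial h}{\partial v}(V)=K\frac{\partial}{\partial\eta}\frac{\partial f}{\partial v}\cdot\frac{\partial g}{\partial v}+K\frac{\partial}{\partial v}\frac{\partial g}{\partial v}\cdot\frac{\partial f}{\partial\eta}-K\frac{\partial}{\partial\eta}\frac{\partial g}{\partial v}\cdot\frac{\partial f}{\partial v}-K\frac{\partial}{\partial v}\frac{\partial f}{\partial v}\cdot\frac{\partial g}{\partial\eta},$$ where the right-hand sides are evaluated at $V$, where for a fibre preserving $\phi:TQ\to TQ$ one sets $K\frac{\partial\phi}{\partial\eta}(V)\cdot W=K\big(T\phi\cdot\Theta_V^{-1}(W,0)\big)$ and $K\frac{\partial\phi}{\partial v}(V)\cdot W=K\big(T\phi\cdot\Theta_V^{-1}(0,W)\big)$,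 and where $\mathcal{R}$ is the Riemann curvature tensor with the sign convention $\mathcal{R}(X,Y)Z=\nabla_Y\nabla_XZ-\nabla_X\nabla_YZ+\nabla_{[X,Y]}Z$. -/

import Mathlib

open scoped Manifold ContDiff Bundle

noncomputable section

namespace WeakPoisson

variable {E : Type*} [NormedAddCommGroup E] [NormedSpace ℝ E]
variable {Q : Type*} [TopologicalSpace Q] [ChartedSpace E Q] [IsManifold 𝓘(ℝ, E) ∞ Q]

variable (E Q) in
/-- The tangent bundle `TQ` of a Banach manifold `Q` modelled on `E`. -/
abbrev TB : Type _ := TangentBundle 𝓘(ℝ, E) Q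

variable (E) in
/-- The tangent space `T_q Q`. -/
abbrev T {Q : Type*} [TopologicalSpace Q] [ChartedSpace E Q] (q : Q) : Type _ :=
  TangentSpace 𝓘(ℝ, E) q

/-- The tangent space `T_V TQ`. -/
abbrev TT (V : TB E Q) : Type _ := TangentSpace 𝓘(ℝ, E).tangent V

variable (E Q) in
/-- A smooth weak Riemannian metric: a smooth field of continuous, symmetric, positive definite
bilinear forms on the tangent spaces. The topology induced by `inner q` on `T_q Q` may be strictly
weaker than the given one. -/
structure WeakRiemannianMetric where
  /-- The scalar product on `T_q Q`. -/
  inner (q : Q) : T E q →L[ℝ] T E q →L[ℝ] ℝ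
  symm (q : Q) (v w : T E q) : inner q v w = inner q w v
  pos (q : Q) (v : T E q) (hv : v ≠ 0) : 0 < inner q v v
  contMDiff : ContMDiff 𝓘(ℝ, E) (𝓘(ℝ, E).prod 𝓘(ℝ, E →L[ℝ] E →L[ℝ] ℝ)) ∞
    (fun q ↦ Bundle.TotalSpace.mk' (E →L[ℝ] E →L[ℝ] ℝ) q (inner q))

/-- The metric read in a chart `e`: the scalar product at `e.symm x` of the tangent vectors with
coordinates `a` and `b`. -/
def WeakRiemannianMetric.local (g : WeakRiemannianMetric E Q) (e : OpenPartialHomeomorph Q E)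
    (x a b : E) : ℝ :=
  g.inner (e.symm x) (mfderiv 𝓘(ℝ, E) 𝓘(ℝ, E) e.symm x a) (mfderiv 𝓘(ℝ, E) 𝓘(ℝ, E) e.symm x b)

/-- The inclusion `T_q Q → T_q^* Q` into the dual, `v ↦ ⟨v, ·⟩_q`, has dense range for every `q`
(the dual carries the topology of the operator norm). -/
def WeakRiemannianMetric.DenseInclusion (g : WeakRiemannianMetric E Q) : Prop :=
  ∀ q : Q, DenseRange (fun v : T E q ↦ (g.inner q v : T E q →L[ℝ] ℝ))

/-- A smooth Riemannian (torsion free and metric) connection for `g`, given by its Christoffel maps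
`Γ e` in the charts `e` of the atlas: in such a chart the covariant derivative of a vector field `b`
in the direction `a` is `Db · a + Γ(x)(b, a)`. -/
structure RiemannianConnection (g : WeakRiemannianMetric E Q) where
  /-- The Christoffel map of the chart `e`. -/
  Γ : OpenPartialHomeomorph Q E → E → E →L[ℝ] E →L[ℝ] E
  smooth : ∀ e ∈ atlas E Q, ContDiffOn ℝ ∞ (Γ e) e.target
  /-- Transformation rule under the change of charts `ψ = e' ∘ e⁻¹`:
  `Dψ(Γ(a, b)) = D²ψ(a, b) + Γ'(Dψ a, Dψ b)`. -/
  transform : ∀ e ∈ atlas E Q, ∀ e' ∈ atlas E Q, ∀ x ∈ (e.symm.trans e').source, ∀ a b : E,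
    fderiv ℝ (e' ∘ e.symm) x (Γ e x a b) =
      fderiv ℝ (fderiv ℝ (e' ∘ e.symm)) x a b +
        Γ e' (e' (e.symm x)) (fderiv ℝ (e' ∘ e.symm) x a) (fderiv ℝ (e' ∘ e.symm) x b)
  torsionFree : ∀ e ∈ atlas E Q, ∀ x ∈ e.target, ∀ a b : E, Γ e x a b = Γ e x b a
  metric : ∀ e ∈ atlas E Q, ∀ x ∈ e.target, ∀ a b c : E,
    fderiv ℝ (fun y ↦ g.local e y a b) x c =
      g.local e x (Γ e x a c) b + g.local e x a (Γ e x b c)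

variable {g : WeakRiemannianMetric E Q}

/-- The Christoffel map at `q` in the preferred chart at `q`. The identification of `T_q Q` with `E`
that is built into `TangentSpace` is the one given by this chart. -/
def RiemannianConnection.christoffel (C : RiemannianConnection g) (q : Q) :
    E →L[ℝ] E →L[ℝ] E :=
  C.Γ (chartAt E q) (chartAt E q q)

/-- The connector `K : T_V TQ → T_q Q` at `V = (q, v)`; in coordinates
`K(q, v, u, w) = w + Γ(q)(v, u)`. An element of `T_V TQ` is, by definition of `TangentSpace`, a pair
`(u, w) : E × E`, the coordinates being those of the chart of `TQ` induced by the preferred chart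
of `Q` at `q`. -/
def RiemannianConnection.connector (C : RiemannianConnection g) (V : TB E Q) :
    TT V →L[ℝ] T E V.proj :=
  (ContinuousLinearMap.snd ℝ E E + (C.christoffel V.proj V.snd).comp (ContinuousLinearMap.fst ℝ E E) :
    E × E →L[ℝ] E)

/-- In the coordinates `(u, w)` of `T_V TQ`, the tangent map of `τ : TQ → Q` is `(u, w) ↦ u`. -/
theorem hasMFDerivAt_proj (V : TB E Q) :
    HasMFDerivAt 𝓘(ℝ, E).tangent 𝓘(ℝ, E) (fun W : TB E Q ↦ W.proj) V
      (ContinuousLinearMap.fst ℝ E E : E × E →L[ℝ] E) := by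
  refine ⟨(FiberBundle.continuous_proj E (T E)).continuousAt, ?_⟩
  have h0 : ((extChartAt 𝓘(ℝ, E).tangent V) V).1 = extChartAt 𝓘(ℝ, E) V.proj V.proj := by
    simp [extChartAt, TangentBundle.coe_chartAt_fst]
  refine HasFDerivWithinAt.congr_of_eventuallyEq (hasFDerivWithinAt_fst (𝕜 := ℝ)) ?_
    (by
      rw [writtenInExtChartAt, Function.comp_apply, Function.comp_apply, extChartAt_to_inv]
      exact h0.symm)
  have h := extChartAt_target_mem_nhdsWithin (I := 𝓘(ℝ, E).tangent) V
  filter_upwards [h] with p hp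
  have h1 : (extChartAt 𝓘(ℝ, E).tangent V).symm p ∈ (extChartAt 𝓘(ℝ, E).tangent V).source :=
    (extChartAt 𝓘(ℝ, E).tangent V).map_target hp
  have h2 := (extChartAt 𝓘(ℝ, E).tangent V).right_inv hp
  have h3 : ((extChartAt 𝓘(ℝ, E).tangent V) ((extChartAt 𝓘(ℝ, E).tangent V).symm p)).1 =
      extChartAt 𝓘(ℝ, E) V.proj (((extChartAt 𝓘(ℝ, E).tangent V).symm p).proj) := by
    simp [extChartAt, TangentBundle.coe_chartAt_fst]
  rw [h2] at h3
  exact h3.symm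

/-- `Θ_V = (Tτ, K) : T_V TQ ≃ T_q Q × T_q Q` for `V ∈ T_q Q`. -/
def RiemannianConnection.theta (C : RiemannianConnection g) (V : TB E Q) :
    TT V ≃L[ℝ] T E V.proj × T E V.proj :=
  ContinuousLinearEquiv.equivOfInverse
    ((mfderiv 𝓘(ℝ, E).tangent 𝓘(ℝ, E) (fun W : TB E Q ↦ W.proj) V).prod (C.connector V))
    ((ContinuousLinearMap.fst ℝ E E).prod
      (ContinuousLinearMap.snd ℝ E E -
        (C.christoffel V.proj V.snd).comp (ContinuousLinearMap.fst ℝ E E)) :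
      E × E →L[ℝ] E × E)
    (by
      rw [(hasMFDerivAt_proj V).mfderiv]
      intro Z
      refine Prod.ext rfl ?_
      exact add_sub_cancel_right (G := E) _ _)
    (by
      rw [(hasMFDerivAt_proj V).mfderiv]
      intro Z
      refine Prod.ext rfl ?_
      exact sub_add_cancel (G := E) _ _)

variable (C : RiemannianConnection g)

/-- The covariant partial derivative `∂f/∂η (V) ∈ T_q^* Q`, `∂f/∂η (V) · W = df · Θ⁻¹(V, W, 0)`. -/
def RiemannianConnection.dBase (f : TB E Q → ℝ) (V : TB E Q) : T E V.proj →L[ℝ] ℝ :=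
  (mfderiv 𝓘(ℝ, E).tangent 𝓘(ℝ, ℝ) f V : TT V →L[ℝ] ℝ).comp
    ((C.theta V).symm.toContinuousLinearMap.comp
      (ContinuousLinearMap.inl ℝ (T E V.proj) (T E V.proj)))

/-- The covariant partial derivative `∂f/∂v (V) ∈ T_q^* Q`, `∂f/∂v (V) · W = df · Θ⁻¹(V, 0, W)`. -/
def RiemannianConnection.dFiber (f : TB E Q → ℝ) (V : TB E Q) : T E V.proj →L[ℝ] ℝ :=
  (mfderiv 𝓘(ℝ, E).tangent 𝓘(ℝ, ℝ) f V : TT V →L[ℝ] ℝ).comp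
    ((C.theta V).symm.toContinuousLinearMap.comp
      (ContinuousLinearMap.inr ℝ (T E V.proj) (T E V.proj)))

/-- The vector `Z ∈ T_q Q` represents the covector `α ∈ T_q^* Q`: `α · X = ⟨Z, X⟩_q` for all `X`. -/
def WeakRiemannianMetric.Represents (g : WeakRiemannianMetric E Q) {q : Q} (Z : T E q)
    (α : T E q →L[ℝ] ℝ) : Prop :=
  ∀ X : T E q, α X = g.inner q Z X

open Classical in
/-- The vector that represents the covector `α` (it is unique if it exists, see `sharp_eq`); zero if
there is none. -/
def WeakRiemannianMetric.sharp (g : WeakRiemannianMetric E Q) {q : Q} (α : T E q →L[ℝ] ℝ) : T E q :=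
  if h : ∃ Z : T E q, g.Represents Z α then h.choose else 0

theorem WeakRiemannianMetric.sharp_eq (g : WeakRiemannianMetric E Q) {q : Q} {Z : T E q}
    {α : T E q →L[ℝ] ℝ} (hZ : g.Represents Z α) : g.sharp α = Z := by
  have h : ∃ Z : T E q, g.Represents Z α := ⟨Z, hZ⟩
  have h1 : g.Represents (g.sharp α) α := by
    rw [WeakRiemannianMetric.sharp, dif_pos h]
    exact h.choose_spec
  by_contra hne
  have h2 := g.pos q (g.sharp α - Z) (sub_ne_zero.mpr hne)
  have h3 : g.inner q (g.sharp α - Z) (g.sharp α - Z) = 0 := by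
    have h4 : ∀ X, g.inner q (g.sharp α) X = g.inner q Z X := fun X ↦ (h1 X).symm.trans (hZ X)
    rw [g.symm, map_sub, g.symm, h4, g.symm q Z, sub_self]
  exact h2.ne' h3

/-- `∂f/∂η (V)` as a vector in `T_q Q`. -/
def RiemannianConnection.gradBase (f : TB E Q → ℝ) (V : TB E Q) : T E V.proj :=
  g.sharp (C.dBase f V)

/-- `∂f/∂v (V)` as a vector in `T_q Q`. -/
def RiemannianConnection.gradFiber (f : TB E Q → ℝ) (V : TB E Q) : T E V.proj :=
  g.sharp (C.dFiber f V)

/-- The fibre preserving map `TQ → TQ` that sends `V ∈ T_q Q` to `F V ∈ T_q Q`. -/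
def fiberMap (F : ∀ V : TB E Q, T E V.proj) (V : TB E Q) : TB E Q :=
  ⟨V.proj, F V⟩

/-- The class `𝒦^k(TQ)`, for `k` finite or `k = ∞`: the functions of class `C^{k+1}` whose covariant
partial derivatives at each point are represented by vectors, which form maps `TQ → TQ` of class
`C^k`. For `k = ∞` this is the class `𝒦(TQ)`. -/
def RiemannianConnection.classK (k : ℕ∞) : Set (TB E Q → ℝ) :=
  {f | ContMDiff 𝓘(ℝ, E).tangent 𝓘(ℝ, ℝ) ((k + 1 : ℕ∞) : WithTop ℕ∞) f ∧
    (∀ V, g.Represents (C.gradBase f V) (C.dBase f V)) ∧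
    (∀ V, g.Represents (C.gradFiber f V) (C.dFiber f V)) ∧
    ContMDiff 𝓘(ℝ, E).tangent 𝓘(ℝ, E).tangent (k : WithTop ℕ∞) (fiberMap (C.gradBase f)) ∧
    ContMDiff 𝓘(ℝ, E).tangent 𝓘(ℝ, E).tangent (k : WithTop ℕ∞) (fiberMap (C.gradFiber f))}

/-- The bracket `{f, h} = ⟨∂f/∂η, ∂h/∂v⟩ - ⟨∂f/∂v, ∂h/∂η⟩`. -/
def RiemannianConnection.bracket (f h : TB E Q → ℝ) (V : TB E Q) : ℝ :=
  g.inner V.proj (C.gradBase f V) (C.gradFiber h V) -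
    g.inner V.proj (C.gradFiber f V) (C.gradBase h V)

/-- `K ∂φ/∂η (V) · W = K (Tφ · Θ⁻¹(V, W, 0))` for the fibre preserving map `φ` given by `F`. -/
def RiemannianConnection.covBase (F : ∀ V : TB E Q, T E V.proj) (V : TB E Q) (W : T E V.proj) :
    T E V.proj :=
  C.connector (fiberMap F V)
    (mfderiv 𝓘(ℝ, E).tangent 𝓘(ℝ, E).tangent (fiberMap F) V ((C.theta V).symm (W, 0)))

/-- `K ∂φ/∂v (V) · W = K (Tφ · Θ⁻¹(V, 0, W))` for the fibre preserving map `φ` given by `F`. -/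
def RiemannianConnection.covFiber (F : ∀ V : TB E Q, T E V.proj) (V : TB E Q) (W : T E V.proj) :
    T E V.proj :=
  C.connector (fiberMap F V)
    (mfderiv 𝓘(ℝ, E).tangent 𝓘(ℝ, E).tangent (fiberMap F) V ((C.theta V).symm (0, W)))

/-- The Riemann curvature tensor, with the sign convention
`R(a, b)c = ∇_b ∇_a c - ∇_a ∇_b c + ∇_{[a, b]} c`. In the preferred chart at `q` it reads
`R(a, b)c = (D_b Γ)(c, a) - (D_a Γ)(c, b) + Γ(Γ(c, a), b) - Γ(Γ(c, b), a)`. -/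
def RiemannianConnection.curvature (q : Q) (a b c : T E q) : T E q :=
  let D : E →L[ℝ] E →L[ℝ] E →L[ℝ] E := fderiv ℝ (C.Γ (chartAt E q)) (chartAt E q q)
  let G : E →L[ℝ] E →L[ℝ] E := C.christoffel q
  (D b c a - D a c b + G (G c a) b - G (G c b) a : E)

end WeakPoisson

end

/-! Write `A`, `B` for the covariant partials of `f`, so that `df` sends the tangent vector with
horizontal part `c` and vertical part `z` to `⟨A, c⟩ + ⟨B, z⟩`. The product rule expresses the
differential of `⟨A₁, B₂⟩ - ⟨B₁, A₂⟩` through covariant derivatives of the `Aᵢ`, `Bᵢ` in the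
direction `(c, z)`. For a weak metric such a functional of `(c, z)` need not be represented by a
vector.

The remedy is symmetry of second derivatives. The covariant Hessian of `f` is symmetric up to the
term `⟨B, R(a, c)v⟩`, because horizontal lifts fail to commute (`coordCov_symm`). Inserting the
Hamiltonian direction `(B₂, -A₂)` of the second function into the Hessian of the first, and
conversely, moves `(c, z)` out of the differentiation and into the other slot of the metric. The
representing vectors are then explicit covariant derivatives along `(B₂, -A₂)` and `(B₁, -A₁)`. The
two curvature terms merge into `⟨R(B₁, B₂)v, c⟩` by the first Bianchi identity and pair symmetry
(`curvature_sub`); `fderiv_bracket` collects the result.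

The formulas contain one derivative of the partials, hence the loss of one order. The calculation is
done in charts and is transferred to `TQ` by the transformation law of `Γ`, which makes `Θ` look the
same in every preferred chart (`mfderiv_tangentChart_theta_symm`). -/

open scoped Topology

noncomputable section

set_option maxSynthPendingDepth 3

namespace WeakPoisson

/-! ### Riemannian calculus on an open subset of a normed space -/

section Calculus

variable {E : Type*} [NormedAddCommGroup E] [NormedSpace ℝ E]

/-- A weak Riemannian metric `G` with its torsion free metric connection `Γ` on an open subset `U`
of a normed space. -/
structure IsRiemannianOn (U : Set E) (G : E → E →L[ℝ] E →L[ℝ] ℝ) (Γ : E → E →L[ℝ] E →L[ℝ] E) :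
    Prop where
  isOpen : IsOpen U
  contDiffOn_metric : ContDiffOn ℝ ∞ G U
  contDiffOn_christoffel : ContDiffOn ℝ ∞ Γ U
  symm : ∀ x ∈ U, ∀ a b, G x a b = G x b a
  torsionFree : ∀ x ∈ U, ∀ a b, Γ x a b = Γ x b a
  metric : ∀ x ∈ U, ∀ a b c, fderiv ℝ G x c a b = G x (Γ x a c) b + G x a (Γ x b c)

/-- The covariant derivative, in coordinates, of the fibre preserving map `(x, v) ↦ (x, F (x, v))`
in the direction with horizontal part `c` and vertical part `z`. -/
def coordCov (Γ : E → E →L[ℝ] E →L[ℝ] E) (F : E × E → E) (p : E × E) (c z : E) : E :=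
  fderiv ℝ F p (c, z - Γ p.1 p.2 c) + Γ p.1 (F p) c

/-- The curvature tensor in coordinates. -/
def coordCurvature (Γ : E → E →L[ℝ] E →L[ℝ] E) (x a b c : E) : E :=
  fderiv ℝ Γ x b c a - fderiv ℝ Γ x a c b + Γ x (Γ x c a) b - Γ x (Γ x c b) a

/-- `A` and `B` are the covariant partial derivatives of `f` in coordinates. -/
def IsCoordGrad (U : Set E) (G : E → E →L[ℝ] E →L[ℝ] ℝ) (Γ : E → E →L[ℝ] E →L[ℝ] E)
    (f : E × E → ℝ) (A B : E × E → E) : Prop :=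
  ∀ p : E × E, p.1 ∈ U → ∀ a w,
    fderiv ℝ f p (a, w) = G p.1 (A p) a + G p.1 (B p) (w + Γ p.1 p.2 a)

variable {U : Set E} {G : E → E →L[ℝ] E →L[ℝ] ℝ} {Γ : E → E →L[ℝ] E →L[ℝ] E}

namespace IsRiemannianOn

theorem mem_nhds (H : IsRiemannianOn U G Γ) {x : E} (hx : x ∈ U) : U ∈ 𝓝 x :=
  H.isOpen.mem_nhds hx

theorem fst_mem_nhds (H : IsRiemannianOn U G Γ) {p : E × E} (hp : p.1 ∈ U) :
    ∀ᶠ q : E × E in 𝓝 p, q.1 ∈ U :=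
  continuous_fst.continuousAt.preimage_mem_nhds (H.mem_nhds hp)

theorem hasFDerivAt_metric (H : IsRiemannianOn U G Γ) {x : E} (hx : x ∈ U) :
    HasFDerivAt G (fderiv ℝ G x) x :=
  ((H.contDiffOn_metric.contDiffAt (H.mem_nhds hx)).differentiableAt (by simp)).hasFDerivAt

theorem hasFDerivAt_christoffel (H : IsRiemannianOn U G Γ) {x : E} (hx : x ∈ U) :
    HasFDerivAt Γ (fderiv ℝ Γ x) x :=
  ((H.contDiffOn_christoffel.contDiffAt (H.mem_nhds hx)).differentiableAt (by simp)).hasFDerivAt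

/-- The second derivative of the metric on the diagonal, computed from the compatibility with the
connection. -/
theorem fderiv_fderiv_metric (H : IsRiemannianOn U G Γ) {x : E} (hx : x ∈ U) (a c d : E) :
    fderiv ℝ (fderiv ℝ G) x d c a a =
      2 * (G x (Γ x (Γ x a c) d) a + G x (Γ x a c) (Γ x a d) + G x (fderiv ℝ Γ x d a c) a) := by
  have h1 : HasFDerivAt (fderiv ℝ G) (fderiv ℝ (fderiv ℝ G) x) x :=
    (((H.contDiffOn_metric.contDiffAt (H.mem_nhds hx)).fderiv_right (m := 1)
      (by exact mod_cast ENat.LEInfty.out)).differentiableAt (by simp)).hasFDerivAt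
  have h2 : HasFDerivAt (fun y ↦ fderiv ℝ G y c a a) _ x :=
    ((h1.clm_apply (hasFDerivAt_const c x)).clm_apply (hasFDerivAt_const a x)).clm_apply
      (hasFDerivAt_const a x)
  have hΓ := ((H.hasFDerivAt_christoffel hx).clm_apply (hasFDerivAt_const a x)).clm_apply
    (hasFDerivAt_const c x)
  have h3 : HasFDerivAt (fun y ↦ 2 * G y (Γ y a c) a) _ x :=
    (((H.hasFDerivAt_metric hx).clm_apply hΓ).clm_apply (hasFDerivAt_const a x)).const_mul 2
  -- By symmetry, compatibility on the diagonal reads `DG(c)(a, a) = 2 G(Γ(a, c), a)` near `x`; both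
  -- sides are differentiated.
  have h4 := h2.unique (h3.congr_of_eventuallyEq (by
    filter_upwards [H.mem_nhds hx] with y hy
    rw [H.metric y hy, H.symm y hy a, two_mul]))
  have h5 := congrArg (fun l : E →L[ℝ] ℝ ↦ l d) h4
  simp only [add_apply, ContinuousLinearMap.comp_apply,
    ContinuousLinearMap.flip_apply, smul_apply, map_zero, zero_add,
    zero_apply, smul_eq_mul] at h5
  rw [h5, H.metric x hx]
  ring

/-- Antisymmetrizing the second derivative of `y ↦ G y c c` in the two directions `a`, `b` gives
zero, and by `fderiv_fderiv_metric` it also gives twice this quantity up to sign. -/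
theorem curvature_self (H : IsRiemannianOn U G Γ) {x : E} (hx : x ∈ U) (a b c : E) :
    G x (coordCurvature Γ x a b c) c = 0 := by
  have hs : IsSymmSndFDerivAt ℝ G x :=
    (H.contDiffOn_metric.contDiffAt (H.mem_nhds hx)).isSymmSndFDerivAt
      (by rw [minSmoothness_of_isRCLikeNormedField]; exact mod_cast ENat.LEInfty.out)
  have h := congrArg (fun l : E →L[ℝ] E →L[ℝ] ℝ ↦ l c c) (hs.eq a b)
  simp only [H.fderiv_fderiv_metric hx] at h
  rw [H.symm x hx (Γ x c b)] at h
  simp only [coordCurvature, map_add, map_sub, add_apply,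
    sub_apply]
  linarith

/-- Polarization of `curvature_self`. -/
theorem curvature_skew (H : IsRiemannianOn U G Γ) {x : E} (hx : x ∈ U) (a b c d : E) :
    G x (coordCurvature Γ x a b c) d = -G x (coordCurvature Γ x a b d) c := by
  have h1 := H.curvature_self hx a b (c + d)
  have h2 := H.curvature_self hx a b c
  have h3 := H.curvature_self hx a b d
  have h4 : coordCurvature Γ x a b (c + d) = coordCurvature Γ x a b c + coordCurvature Γ x a b d := by
    simp only [coordCurvature, map_add, add_apply]
    abel
  rw [h4] at h1
  simp only [map_add, add_apply] at h1
  linarith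

theorem curvature_swap (x a b c : E) :
    coordCurvature Γ x a b c = -coordCurvature Γ x b a c := by
  simp only [coordCurvature]
  abel

theorem fderiv_christoffel_symm (H : IsRiemannianOn U G Γ) {x : E} (hx : x ∈ U) (a b c : E) :
    fderiv ℝ Γ x c a b = fderiv ℝ Γ x c b a := by
  have h1 : ∀ u w : E, HasFDerivAt (fun y ↦ Γ y u w) _ x := fun u w ↦
    ((H.hasFDerivAt_christoffel hx).clm_apply (hasFDerivAt_const u x)).clm_apply
      (hasFDerivAt_const w x)
  have h2 := (h1 a b).unique ((h1 b a).congr_of_eventuallyEq (by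
    filter_upwards [H.mem_nhds hx] with y hy
    exact H.torsionFree y hy a b))
  simpa using congrArg (fun l : E →L[ℝ] E ↦ l c) h2

/-- The first Bianchi identity. -/
theorem bianchi (H : IsRiemannianOn U G Γ) {x : E} (hx : x ∈ U) (a b c : E) :
    coordCurvature Γ x a b c + coordCurvature Γ x b c a + coordCurvature Γ x c a b = 0 := by
  simp only [coordCurvature]
  rw [H.fderiv_christoffel_symm hx c a b, H.fderiv_christoffel_symm hx c b a,
    H.fderiv_christoffel_symm hx a b c, H.torsionFree x hx c a, H.torsionFree x hx c b,
    H.torsionFree x hx b a]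
  abel

/-- A signed sum of four Bianchi identities, one for each choice of the last argument; skewness in
both pairs cancels everything but twice the difference of the two sides. -/
theorem curvature_pair_symm (H : IsRiemannianOn U G Γ) {x : E} (hx : x ∈ U) (a b c d : E) :
    G x (coordCurvature Γ x a b c) d = G x (coordCurvature Γ x c d a) b := by
  have hB : ∀ a b c d, G x (coordCurvature Γ x a b c) d + G x (coordCurvature Γ x b c a) d +
      G x (coordCurvature Γ x c a b) d = 0 := fun a b c d ↦ by
    have := congrArg (fun w ↦ G x w d) (H.bianchi hx a b c)
    simpa using this
  have hs := H.curvature_skew hx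
  have hw : ∀ a b c d, G x (coordCurvature Γ x a b c) d = -G x (coordCurvature Γ x b a c) d :=
    fun a b c d ↦ by rw [curvature_swap]; simp
  linarith [hB a b c d, hB b c d a, hB c d a b, hB d a b c, hs a b c d, hs b c a d, hs c a b d,
    hs b c d a, hs c d b a, hs d b c a, hs c d a b, hs d a c b, hs a c d b, hs d a b c, hs a b d c,
    hs b d a c, hw a b c d, hw b c a d, hw c a b d, hw b c d a, hw c d b a, hw d b c a, hw c d a b,
    hw d a c b, hw a c d b, hw d a b c, hw a b d c, hw b d a c]

/-- Pair symmetry moves `c` to the last slot, where Bianchi applies. This merges the curvature terms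
coming from the Hessians of the two functions in the bracket. -/
theorem curvature_sub (H : IsRiemannianOn U G Γ) {x : E} (hx : x ∈ U) (a b c v : E) :
    G x b (coordCurvature Γ x a c v) - G x a (coordCurvature Γ x b c v) =
      G x (coordCurvature Γ x a b v) c := by
  rw [H.symm x hx b, H.symm x hx a, H.curvature_pair_symm hx a c v b,
    H.curvature_pair_symm hx b c v a]
  have h := congrArg (fun w ↦ G x w c) (H.bianchi hx a b v)
  rw [curvature_swap x b v a] at h
  simp only [map_add, map_neg, add_apply, neg_apply,
    map_zero, zero_apply] at h
  linarith

/-- The product rule for the metric along `TU`. -/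
theorem fderiv_inner (H : IsRiemannianOn U G Γ) {X Y : E × E → E} {p : E × E} (hp : p.1 ∈ U)
    (hX : DifferentiableAt ℝ X p) (hY : DifferentiableAt ℝ Y p) (c z : E) :
    fderiv ℝ (fun q : E × E ↦ G q.1 (X q) (Y q)) p (c, z - Γ p.1 p.2 c) =
      G p.1 (coordCov Γ X p c z) (Y p) + G p.1 (X p) (coordCov Γ Y p c z) := by
  have hG : HasFDerivAt (fun q : E × E ↦ G q.1) _ p :=
    (H.hasFDerivAt_metric hp).comp p (hasFDerivAt_fst (𝕜 := ℝ))
  rw [((hG.clm_apply hX.hasFDerivAt).clm_apply hY.hasFDerivAt).fderiv]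
  simp only [add_apply, ContinuousLinearMap.comp_apply,
    ContinuousLinearMap.flip_apply, ContinuousLinearMap.coe_fst', H.metric _ hp, coordCov,
    map_add]
  ring

/-- The symmetry of the second covariant derivatives of a function on `TU`. -/
theorem coordCov_symm (H : IsRiemannianOn U G Γ) {f : E × E → ℝ} {A B : E × E → E}
    (hf : IsCoordGrad U G Γ f A B) {p : E × E} (hp : p.1 ∈ U) (hf2 : ContDiffAt ℝ 2 f p)
    (hA : DifferentiableAt ℝ A p) (hB : DifferentiableAt ℝ B p) (a w c z : E) :
    G p.1 (coordCov Γ A p c z) a + G p.1 (coordCov Γ B p c z) w +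
        G p.1 (B p) (coordCurvature Γ p.1 a c p.2) =
      G p.1 (coordCov Γ A p a w) c + G p.1 (coordCov Γ B p a w) z := by
  -- The second vector is frozen at its value at `p` while `q` varies, so its vertical part at `q`
  -- is `w - Γ p.1 p.2 a + Γ q.1 q.2 a`. Differentiating this correction yields the last line of
  -- `key`, the only one that contributes curvature.
  have key : ∀ a w c z : E,
      fderiv ℝ (fderiv ℝ f) p (c, z - Γ p.1 p.2 c) (a, w - Γ p.1 p.2 a) =
        G p.1 (coordCov Γ A p c z) a + G p.1 (coordCov Γ B p c z) w +
        (G p.1 (A p) (Γ p.1 a c) + G p.1 (B p) (Γ p.1 w c + Γ p.1 z a)) +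
        G p.1 (B p) (fderiv ℝ Γ p.1 c p.2 a - Γ p.1 (Γ p.1 p.2 c) a) := by
    intro a w c z
    have h1 : HasFDerivAt (fun q ↦ fderiv ℝ f q (a, w - Γ p.1 p.2 a)) _ p :=
      ((hf2.fderiv_right (m := 1) (by norm_num)).differentiableAt
        (by simp)).hasFDerivAt.clm_apply (hasFDerivAt_const _ p)
    have hG : HasFDerivAt (fun q : E × E ↦ G q.1) _ p :=
      (H.hasFDerivAt_metric hp).comp p (hasFDerivAt_fst (𝕜 := ℝ))
    have hΓ : HasFDerivAt (fun q : E × E ↦ Γ q.1) _ p :=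
      (H.hasFDerivAt_christoffel hp).comp p (hasFDerivAt_fst (𝕜 := ℝ))
    have h2 : HasFDerivAt (fun q : E × E ↦
        G q.1 (A q) a + G q.1 (B q) (w - Γ p.1 p.2 a + Γ q.1 q.2 a)) _ p :=
      ((hG.clm_apply hA.hasFDerivAt).clm_apply (hasFDerivAt_const a p)).add
        ((hG.clm_apply hB.hasFDerivAt).clm_apply
          (((hΓ.clm_apply hasFDerivAt_snd).clm_apply (hasFDerivAt_const a p)).const_add _))
    have h3 := h1.unique (h2.congr_of_eventuallyEq (by
      filter_upwards [H.fst_mem_nhds hp] with q hq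
      exact hf q hq _ _))
    have h4 := congrArg (fun l : E × E →L[ℝ] ℝ ↦ l (c, z - Γ p.1 p.2 c)) h3
    simp only [add_apply, ContinuousLinearMap.comp_apply,
      ContinuousLinearMap.flip_apply, ContinuousLinearMap.coe_fst', ContinuousLinearMap.coe_snd',
      map_zero, zero_add, zero_apply, H.metric _ hp, map_add, map_sub,
      sub_add_cancel] at h4
    simp only [coordCov, map_add, map_sub, add_apply, sub_apply] at h4 ⊢
    linarith
  -- Under exchange of `(a, w)` and `(c, z)` the middle group of `key` is invariant, by torsion
  -- freeness; the last group changes by the curvature.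
  have hs := (hf2.isSymmSndFDerivAt (by simp)).eq (c, z - Γ p.1 p.2 c) (a, w - Γ p.1 p.2 a)
  rw [key, key, H.torsionFree _ hp c a] at hs
  simp only [coordCurvature, map_add, map_sub] at hs ⊢
  linarith

/-- The covariant partial derivatives of a Poisson bracket, in coordinates. -/
theorem fderiv_bracket (H : IsRiemannianOn U G Γ) {f₁ f₂ : E × E → ℝ} {A₁ B₁ A₂ B₂ : E × E → E}
    (h₁ : IsCoordGrad U G Γ f₁ A₁ B₁) (h₂ : IsCoordGrad U G Γ f₂ A₂ B₂) {p : E × E}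
    (hp : p.1 ∈ U) (hf₁ : ContDiffAt ℝ 2 f₁ p) (hf₂ : ContDiffAt ℝ 2 f₂ p)
    (hA₁ : DifferentiableAt ℝ A₁ p) (hB₁ : DifferentiableAt ℝ B₁ p)
    (hA₂ : DifferentiableAt ℝ A₂ p) (hB₂ : DifferentiableAt ℝ B₂ p) (c z : E) :
    fderiv ℝ (fun q : E × E ↦ G q.1 (A₁ q) (B₂ q) - G q.1 (B₁ q) (A₂ q)) p
        (c, z - Γ p.1 p.2 c) =
      G p.1 (coordCov Γ A₁ p (B₂ p) 0 + coordCov Γ A₂ p 0 (A₁ p) - coordCov Γ A₂ p (B₁ p) 0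
          - coordCov Γ A₁ p 0 (A₂ p) + coordCurvature Γ p.1 (B₁ p) (B₂ p) p.2) c +
        G p.1 (coordCov Γ B₁ p (B₂ p) 0 + coordCov Γ B₂ p 0 (A₁ p) - coordCov Γ B₂ p (B₁ p) 0
          - coordCov Γ B₁ p 0 (A₂ p)) z := by
  have hG : DifferentiableAt ℝ (fun q : E × E ↦ G q.1) p :=
    ((H.hasFDerivAt_metric hp).comp p (hasFDerivAt_fst (𝕜 := ℝ))).differentiableAt
  have hcov : ∀ (F : E × E → E) (a w : E),
      coordCov Γ F p a (-w) = coordCov Γ F p a 0 - coordCov Γ F p 0 w := by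
    intro F a w
    have : ((a, -w - Γ p.1 p.2 a) : E × E) = (a, 0 - Γ p.1 p.2 a) - (0, w - Γ p.1 p.2 0) := by
      simp [sub_eq_add_neg, add_comm]
    simp only [coordCov, this, map_sub, map_zero]
    abel
  rw [fderiv_fun_sub ((hG.clm_apply hA₁).clm_apply hB₂) ((hG.clm_apply hB₁).clm_apply hA₂),
    sub_apply, H.fderiv_inner hp hA₁ hB₂, H.fderiv_inner hp hB₁ hA₂]
  -- `(B₂, -A₂)` and `(B₁, -A₁)` are the horizontal and vertical parts of the Hamiltonian vector
  -- fields of `f₂` and `f₁`. With these choices the left sides of `k₁` and `k₂` contain exactly the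
  -- terms of the product rule.
  have k₁ := H.coordCov_symm h₁ hp hf₁ hA₁ hB₁ (B₂ p) (-A₂ p) c z
  have k₂ := H.coordCov_symm h₂ hp hf₂ hA₂ hB₂ (B₁ p) (-A₁ p) c z
  have k₃ := H.curvature_sub hp (B₁ p) (B₂ p) c p.2
  rw [hcov, hcov] at k₁ k₂
  rw [H.symm _ hp (A₁ p), H.symm _ hp (B₁ p)]
  simp only [map_add, map_sub, map_neg, add_apply,
    sub_apply] at k₁ k₂ k₃ ⊢
  linarith

end IsRiemannianOn

end Calculus

/-! ### Charts of the tangent bundle and their derivatives -/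

section Charts

variable {E : Type*} [NormedAddCommGroup E] [NormedSpace ℝ E]
variable {Q : Type*} [TopologicalSpace Q] [ChartedSpace E Q] [IsManifold 𝓘(ℝ, E) ∞ Q]

variable (E) in
/-- The coordinates of tangent vectors at `q` in the preferred chart at `q₀`. -/
def toCoord (q₀ q : Q) : T E q →L[ℝ] E :=
  (trivializationAt E (T E) q₀).continuousLinearMapAt ℝ q

variable (E) in
/-- The tangent vector at `q` with given coordinates in the preferred chart at `q₀`. -/
def ofCoord (q₀ q : Q) : E →L[ℝ] T E q :=
  (trivializationAt E (T E) q₀).symmL ℝ q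

variable (E) in
/-- The chart of `TQ` induced by the preferred chart of `Q` at `q₀`. -/
def tangentChart (q₀ : Q) : PartialEquiv (TB E Q) (E × E) :=
  extChartAt 𝓘(ℝ, E).tangent (⟨q₀, (0 : E)⟩ : TB E Q)

variable {q₀ q : Q}

theorem ofCoord_toCoord (hq : q ∈ (chartAt E q₀).source) (v : T E q) :
    ofCoord E q₀ q (toCoord E q₀ q v) = v :=
  (trivializationAt E (T E) q₀).symmL_continuousLinearMapAt hq v

theorem toCoord_ofCoord (hq : q ∈ (chartAt E q₀).source) (a : E) :
    toCoord E q₀ q (ofCoord E q₀ q a) = a :=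
  (trivializationAt E (T E) q₀).continuousLinearMapAt_symmL hq a

theorem toCoord_eq_tangentCoordChange (hq : q ∈ (chartAt E q₀).source) :
    toCoord E q₀ q = tangentCoordChange 𝓘(ℝ, E) q q₀ q :=
  TangentBundle.continuousLinearMapAt_trivializationAt_eq_core hq

theorem ofCoord_eq_tangentCoordChange (hq : q ∈ (chartAt E q₀).source) :
    ofCoord E q₀ q = tangentCoordChange 𝓘(ℝ, E) q₀ q q :=
  TangentBundle.symmL_trivializationAt_eq_core hq

theorem tangentCoordChange_eq_fderiv (q₁ q₀ q : Q) :
    tangentCoordChange 𝓘(ℝ, E) q₁ q₀ q =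
      fderiv ℝ (chartAt E q₀ ∘ (chartAt E q₁).symm) (chartAt E q₁ q) := by
  rw [tangentCoordChange_def]
  simp [extChartAt, fderivWithin_univ]

theorem toCoord_self (v : T E q) : toCoord E q q v = v := by
  rw [toCoord_eq_tangentCoordChange (mem_chart_source E q)]
  exact (tangentBundleCore 𝓘(ℝ, E) Q).coordChange_self (achart E q) q (mem_chart_source E q) v

theorem ofCoord_self (a : E) : ofCoord E q q a = a := by
  rw [ofCoord_eq_tangentCoordChange (mem_chart_source E q)]
  exact (tangentBundleCore 𝓘(ℝ, E) Q).coordChange_self (achart E q) q (mem_chart_source E q) a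

theorem ofCoord_eq_mfderiv (hq : q ∈ (chartAt E q₀).source) :
    ofCoord E q₀ q = mfderiv 𝓘(ℝ, E) 𝓘(ℝ, E) (chartAt E q₀).symm (chartAt E q₀ q) := by
  have h := TangentBundle.symmL_trivializationAt (I := 𝓘(ℝ, E)) hq
  simpa [extChartAt, mfderivWithin_univ] using! h

theorem mem_tangentChart_source {V : TB E Q} :
    V ∈ (tangentChart E q₀).source ↔ V.proj ∈ (chartAt E q₀).source := by
  rw [tangentChart, extChartAt_source, TangentBundle.mem_chart_source_iff]

theorem mem_tangentChart_target {p : E × E} :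
    p ∈ (tangentChart E q₀).target ↔ p.1 ∈ (chartAt E q₀).target := by
  rw [tangentChart, extChartAt_target]
  simp only [ModelWithCorners.range_eq_univ, Set.inter_univ]
  exact TangentBundle.mem_chart_target_iff p _

theorem tangentChart_target :
    (tangentChart E q₀).target = (chartAt E q₀).target ×ˢ Set.univ := by
  ext p
  simp [mem_tangentChart_target]

theorem isOpen_tangentChart_source : IsOpen (tangentChart E q₀).source :=
  isOpen_extChartAt_source _

theorem tangentChart_apply {V : TB E Q} (hV : V.proj ∈ (chartAt E q₀).source) :
    tangentChart E q₀ V = (chartAt E q₀ V.proj, toCoord E q₀ V.proj V.snd) := by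
  rw [toCoord_eq_tangentCoordChange hV]
  rfl

theorem tangentChart_symm_proj_mem {p : E × E} (hp : p.1 ∈ (chartAt E q₀).target) :
    ((tangentChart E q₀).symm p).proj ∈ (chartAt E q₀).source :=
  (chartAt E q₀).map_target hp

theorem toCoord_tangentChart_symm {p : E × E} (hp : p.1 ∈ (chartAt E q₀).target) :
    toCoord E q₀ ((tangentChart E q₀).symm p).proj ((tangentChart E q₀).symm p).snd = p.2 := by
  have h := (tangentChart E q₀).right_inv (mem_tangentChart_target.2 hp)
  rw [tangentChart_apply (tangentChart_symm_proj_mem hp)] at h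
  exact congrArg Prod.snd h

theorem tangentChart_symm_snd {p : E × E} (hp : p.1 ∈ (chartAt E q₀).target) :
    ((tangentChart E q₀).symm p).snd = ofCoord E q₀ ((tangentChart E q₀).symm p).proj p.2 := by
  rw [← ofCoord_toCoord (tangentChart_symm_proj_mem hp) ((tangentChart E q₀).symm p).snd,
    toCoord_tangentChart_symm hp]

theorem toCoord_ofCoord_eq {q₁ : Q} (hq : q ∈ (chartAt E q₀).source)
    (hq₁ : q ∈ (chartAt E q₁).source) (a : E) :
    toCoord E q₀ q (ofCoord E q₁ q a) =
      fderiv ℝ (chartAt E q₀ ∘ (chartAt E q₁).symm) (chartAt E q₁ q) a := by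
  rw [toCoord_eq_tangentCoordChange hq, ofCoord_eq_tangentCoordChange hq₁,
    ← tangentCoordChange_eq_fderiv]
  refine tangentCoordChange_comp ?_
  simp [hq, hq₁]

/-- The derivative of the tangent map `(y, w) ↦ (ψ y, Dψ(y) w)`. -/
theorem hasFDerivAt_tangentMap {F : Type*} [NormedAddCommGroup F] [NormedSpace ℝ F] {ψ : E → F}
    {x : E} (hψ : ContDiffAt ℝ 2 ψ x) (v : E) :
    HasFDerivAt (fun p : E × E ↦ (ψ p.1, fderiv ℝ ψ p.1 p.2))
      (((fderiv ℝ ψ x).comp (ContinuousLinearMap.fst ℝ E E)).prod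
        (((fderiv ℝ (fderiv ℝ ψ) x).flip v).comp (ContinuousLinearMap.fst ℝ E E) +
          (fderiv ℝ ψ x).comp (ContinuousLinearMap.snd ℝ E E))) (x, v) := by
  have h1 : HasFDerivAt (fun p : E × E ↦ ψ p.1) _ (x, v) :=
    (hψ.differentiableAt (by simp)).hasFDerivAt.comp (x, v) (hasFDerivAt_fst (𝕜 := ℝ))
  have h2 : HasFDerivAt (fun p : E × E ↦ fderiv ℝ ψ p.1) _ (x, v) :=
    ((hψ.fderiv_right (m := 1) (by norm_num)).differentiableAt
      (by simp)).hasFDerivAt.comp (x, v) (hasFDerivAt_fst (𝕜 := ℝ))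
  refine (h1.prodMk (h2.clm_apply (hasFDerivAt_snd (𝕜 := ℝ)))).congr_fderiv ?_
  ext a <;> simp

theorem contDiffAt_coordChange (hq : q ∈ (chartAt E q₀).source) {q₁ : Q}
    (hq₁ : q ∈ (chartAt E q₁).source) :
    ContDiffAt ℝ ∞ (chartAt E q₀ ∘ (chartAt E q₁).symm) (chartAt E q₁ q) := by
  have h := contDiffWithinAt_ext_coord_change (I := 𝓘(ℝ, E)) (n := ∞) q₀ q₁
    (y := chartAt E q₁ q) (by simp [extChartAt, hq, hq₁])
  simpa [extChartAt, contDiffWithinAt_univ] using! h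

/-- The derivative of the charts of `TQ`, in the coordinates of `T_V TQ`. -/
theorem hasMFDerivAt_tangentChart {V : TB E Q} (hV : V.proj ∈ (chartAt E q₀).source) :
    HasMFDerivAt 𝓘(ℝ, E).tangent 𝓘(ℝ, E × E) (tangentChart E q₀) V
      (((toCoord E q₀ V.proj).comp (ContinuousLinearMap.fst ℝ E E)).prod
        (((fderiv ℝ (fderiv ℝ (chartAt E q₀ ∘ (chartAt E V.proj).symm))
          (chartAt E V.proj V.proj)).flip V.snd).comp (ContinuousLinearMap.fst ℝ E E) +
        (toCoord E q₀ V.proj).comp (ContinuousLinearMap.snd ℝ E E)) : E × E →L[ℝ] E × E) := by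
  obtain ⟨q, v⟩ := V
  change E at v
  have hq : q ∈ (chartAt E q₀).source := hV
  have hqq := mem_chart_source E q
  have hx0 : extChartAt 𝓘(ℝ, E).tangent (⟨q, v⟩ : TB E Q) ⟨q, v⟩ = (chartAt E q q, v) := by
    refine (tangentChart_apply (V := ⟨q, v⟩) hqq).trans ?_
    rw [toCoord_self]
  have hℓ : (toCoord E q₀ q : E →L[ℝ] E) =
      fderiv ℝ (chartAt E q₀ ∘ (chartAt E q).symm) (chartAt E q q) := by
    rw [toCoord_eq_tangentCoordChange hq, tangentCoordChange_eq_fderiv]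
  have hmain := hasFDerivAt_tangentMap
    ((contDiffAt_coordChange hq hqq).of_le (m := 2) (by exact mod_cast ENat.LEInfty.out)) v
  rw [← hℓ] at hmain
  refine ⟨?_, ?_⟩
  · exact (continuousOn_extChartAt _).continuousAt
      (isOpen_tangentChart_source.mem_nhds (mem_tangentChart_source.2 hq))
  · rw [hx0]
    refine (HasFDerivAt.congr_of_eventuallyEq hmain ?_).hasFDerivWithinAt
    have hopen := ((chartAt E q).symm.trans (chartAt E q₀)).open_source.mem_nhds
      (x := chartAt E q q) (by simp [hq])
    filter_upwards [continuous_fst.continuousAt.preimage_mem_nhds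
      (x := (chartAt E q q, v)) hopen] with p hp
    have hp1 : p.1 ∈ (chartAt E q).target := by
      simp at hp
      exact hp.1
    have hp2 : (chartAt E q).symm p.1 ∈ (chartAt E q₀).source := by
      simp at hp
      exact hp.2
    -- The chart of `TQ` at a vector depends only on its base point, so the coordinates of `T_V TQ`
    -- are those of `tangentChart E q`, and the transition is the tangent map of `ψ`.
    change tangentChart E q₀ ((tangentChart E q).symm p) = _
    rw [tangentChart_apply hp2, tangentChart_symm_snd hp1]
    refine Prod.ext rfl ?_
    refine (toCoord_ofCoord_eq (q₀ := q₀) (q₁ := q) hp2 ((chartAt E q).map_target hp1) p.2).trans ?_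
    rw [(chartAt E q).right_inv hp1]

end Charts

/-! ### Metric, connection and the splitting `Θ` in coordinates -/

section Coordinates

variable {E : Type*} [NormedAddCommGroup E] [NormedSpace ℝ E]
variable {Q : Type*} [TopologicalSpace Q] [ChartedSpace E Q] [IsManifold 𝓘(ℝ, E) ∞ Q]
variable {g : WeakRiemannianMetric E Q} {q₀ q : Q}

/-- The metric in the preferred chart at `q₀`. -/
def WeakRiemannianMetric.coord (g : WeakRiemannianMetric E Q) (q₀ : Q) (x : E) :
    E →L[ℝ] E →L[ℝ] ℝ :=
  ContinuousLinearMap.inCoordinates E (T E) (E →L[ℝ] ℝ) (fun q : Q ↦ T E q →L[ℝ] ℝ)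
    q₀ ((chartAt E q₀).symm x) q₀ ((chartAt E q₀).symm x) (g.inner ((chartAt E q₀).symm x))

theorem WeakRiemannianMetric.coord_apply {x : E}
    (hx : x ∈ (chartAt E q₀).target) (a b : E) :
    g.coord q₀ x a b = g.inner ((chartAt E q₀).symm x) (ofCoord E q₀ _ a) (ofCoord E q₀ _ b) := by
  have hq : (chartAt E q₀).symm x ∈ (chartAt E q₀).source := (chartAt E q₀).map_target hx
  refine (inCoordinates_apply_eq₂ (E₃ := Bundle.Trivial Q ℝ) hq hq (Set.mem_univ _)).trans ?_
  have hs (a : E) : ofCoord E q₀ ((chartAt E q₀).symm x) a =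
      (trivializationAt E (T E) q₀).symm ((chartAt E q₀).symm x) a :=
    Bundle.Trivialization.symmL_apply (R := ℝ) _ hq a
  rw [hs, hs]
  simp

theorem WeakRiemannianMetric.coord_toCoord (hq : q ∈ (chartAt E q₀).source) (v w : T E q) :
    g.coord q₀ (chartAt E q₀ q) (toCoord E q₀ q v) (toCoord E q₀ q w) = g.inner q v w := by
  rw [g.coord_apply ((chartAt E q₀).map_source hq), (chartAt E q₀).left_inv hq,
    ofCoord_toCoord hq, ofCoord_toCoord hq]

/-- `coord` is the section `g.inner` read in the trivialization of the bundle of bilinear forms, so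
it inherits the smoothness of the section. -/
theorem WeakRiemannianMetric.contDiffOn_coord (g : WeakRiemannianMetric E Q) (q₀ : Q) :
    ContDiffOn ℝ ∞ (g.coord q₀) (chartAt E q₀).target := by
  rw [← contMDiffOn_iff_contDiffOn]
  intro x hx
  have hq : (chartAt E q₀).symm x ∈ (chartAt E q₀).source := (chartAt E q₀).map_target hx
  have h := (Bundle.Trivialization.contMDiffAt_section_iff (n := ∞) (s := g.inner)
    (trivializationAt (E →L[ℝ] E →L[ℝ] ℝ) (fun q : Q ↦ T E q →L[ℝ] T E q →L[ℝ] ℝ) q₀)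
    (x₀ := (chartAt E q₀).symm x) ⟨hq, hq, Set.mem_univ _⟩).1 (g.contMDiff _)
  exact h.comp_contMDiffWithinAt x (contMDiffOn_chart_symm (I := 𝓘(ℝ, E)) (n := ∞) x hx)

theorem WeakRiemannianMetric.local_eq_coord {x : E} (hx : x ∈ (chartAt E q₀).target) (a b : E) :
    g.local (chartAt E q₀) x a b = g.coord q₀ x a b := by
  rw [g.coord_apply hx, ofCoord_eq_mfderiv ((chartAt E q₀).map_target hx)]
  rw [(chartAt E q₀).right_inv hx]
  rfl

/-- Makes the calculus on open sets available in every preferred chart. -/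
theorem RiemannianConnection.isRiemannianOn (C : RiemannianConnection g) (q₀ : Q) :
    IsRiemannianOn (chartAt E q₀).target (g.coord q₀) (C.Γ (chartAt E q₀)) where
  isOpen := (chartAt E q₀).open_target
  contDiffOn_metric := g.contDiffOn_coord q₀
  contDiffOn_christoffel := C.smooth _ (chart_mem_atlas E q₀)
  symm x hx a b := by rw [g.coord_apply hx, g.coord_apply hx, g.symm]
  torsionFree := C.torsionFree _ (chart_mem_atlas E q₀)
  metric x hx a b c := by
    rw [← g.local_eq_coord hx, ← g.local_eq_coord hx, ← C.metric _ (chart_mem_atlas E q₀) x hx]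
    have hnhds := (chartAt E q₀).open_target.mem_nhds hx
    have h1 := (((g.contDiffOn_coord q₀).contDiffAt hnhds).differentiableAt (by simp)).hasFDerivAt
    have h2 : HasFDerivAt (fun y ↦ g.coord q₀ y a b) _ x :=
      (h1.clm_apply (hasFDerivAt_const a x)).clm_apply (hasFDerivAt_const b x)
    rw [(h2.congr_of_eventuallyEq (by
      filter_upwards [hnhds] with y hy using g.local_eq_coord hy a b)).fderiv]
    simp

/-- The splitting of `T_V TQ` into horizontal and vertical vectors, in coordinates. -/
theorem RiemannianConnection.mfderiv_tangentChart_theta_symm (C : RiemannianConnection g)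
    {V : TB E Q} (hV : V.proj ∈ (chartAt E q₀).source) (W W' : T E V.proj) :
    mfderiv 𝓘(ℝ, E).tangent 𝓘(ℝ, E × E) (tangentChart E q₀) V ((C.theta V).symm (W, W')) =
      ((toCoord E q₀ V.proj W, toCoord E q₀ V.proj W' -
        C.Γ (chartAt E q₀) (tangentChart E q₀ V).1 (tangentChart E q₀ V).2
          (toCoord E q₀ V.proj W)) : E × E) := by
  rw [(hasMFDerivAt_tangentChart hV).mfderiv, tangentChart_apply hV]
  have hqq := mem_chart_source E V.proj
  have hx : chartAt E V.proj V.proj ∈ ((chartAt E V.proj).symm.trans (chartAt E q₀)).source := by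
    simp [hV]
  -- The chart derivative adds `D²ψ(W, v)` to the vertical part, while the transformation law
  -- replaces `Dψ(Γ(v, W))` by `D²ψ(v, W) + Γ'`. The second derivatives cancel by symmetry.
  have ht := C.transform _ (chart_mem_atlas E V.proj) _ (chart_mem_atlas E q₀) _ hx V.snd W
  rw [(chartAt E V.proj).left_inv hqq, ← tangentCoordChange_eq_fderiv,
    ← toCoord_eq_tangentCoordChange hV] at ht
  have hs := (contDiffAt_coordChange hV hqq).isSymmSndFDerivAt
    (by rw [minSmoothness_of_isRCLikeNormedField]; exact mod_cast ENat.LEInfty.out)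
  refine Prod.ext rfl ?_
  change E at W'
  change fderiv ℝ (fderiv ℝ (chartAt E q₀ ∘ (chartAt E V.proj).symm)) (chartAt E V.proj V.proj)
    W V.snd + toCoord E q₀ V.proj (W' - C.christoffel V.proj V.snd W) = _
  refine (congrArg (_ + ·) ((toCoord E q₀ V.proj : E →L[ℝ] E).map_sub W' _)).trans ?_
  have key : ∀ d d' l x y : E, d = d' → x = d' + y → d + (l - x) = l - y := by
    rintro d _ l _ y rfl rfl
    abel
  exact key _ _ _ _ _ (hs.eq W V.snd) ht

end Coordinates

/-! ### Functions and fibre preserving maps in coordinates -/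

section Functions

variable {E : Type*} [NormedAddCommGroup E] [NormedSpace ℝ E]
variable {Q : Type*} [TopologicalSpace Q] [ChartedSpace E Q] [IsManifold 𝓘(ℝ, E) ∞ Q]
variable {q₀ : Q} {n : ℕ∞}

/-- A function on `TQ` in the chart of `TQ` at `q₀`. -/
def coordFun (q₀ : Q) (f : TB E Q → ℝ) (p : E × E) : ℝ :=
  f ((tangentChart E q₀).symm p)

/-- A fibre preserving map `TQ → TQ` in the chart of `TQ` at `q₀`. -/
def coordMap (q₀ : Q) (F : ∀ V : TB E Q, T E V.proj) (p : E × E) : E :=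
  toCoord E q₀ ((tangentChart E q₀).symm p).proj (F ((tangentChart E q₀).symm p))

theorem tangentChart_fst_mem {V : TB E Q} (hV : V.proj ∈ (chartAt E q₀).source) :
    (tangentChart E q₀ V).1 ∈ (chartAt E q₀).target := by
  rw [tangentChart_apply hV]
  exact (chartAt E q₀).map_source hV

theorem tangentChart_left_inv {V : TB E Q} (hV : V.proj ∈ (chartAt E q₀).source) :
    (tangentChart E q₀).symm (tangentChart E q₀ V) = V :=
  (tangentChart E q₀).left_inv (mem_tangentChart_source.2 hV)

theorem coordFun_tangentChart (f : TB E Q → ℝ) {V : TB E Q}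
    (hV : V.proj ∈ (chartAt E q₀).source) :
    coordFun q₀ f (tangentChart E q₀ V) = f V := by
  rw [coordFun, tangentChart_left_inv hV]

theorem coordMap_tangentChart (F : ∀ V : TB E Q, T E V.proj) {V : TB E Q}
    (hV : V.proj ∈ (chartAt E q₀).source) :
    coordMap q₀ F (tangentChart E q₀ V) = toCoord E q₀ V.proj (F V) := by
  rw [coordMap, tangentChart_left_inv hV]

theorem eventually_proj_mem_source {V : TB E Q} (hV : V.proj ∈ (chartAt E q₀).source) :
    ∀ᶠ W : TB E Q in 𝓝 V, W.proj ∈ (chartAt E q₀).source := by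
  filter_upwards [isOpen_tangentChart_source.mem_nhds (mem_tangentChart_source.2 hV)] with W hW
  exact mem_tangentChart_source.1 hW

theorem contMDiffOn_tangentChart_symm (q₀ : Q) :
    ContMDiffOn 𝓘(ℝ, E × E) 𝓘(ℝ, E).tangent n (tangentChart E q₀).symm
      ((chartAt E q₀).target ×ˢ Set.univ) := by
  rw [← tangentChart_target]
  exact contMDiffOn_extChartAt_symm _

theorem contMDiffAt_tangentChart {V : TB E Q} (hV : V.proj ∈ (chartAt E q₀).source) :
    ContMDiffAt 𝓘(ℝ, E).tangent 𝓘(ℝ, E × E) n (tangentChart E q₀) V :=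
  contMDiffAt_extChartAt' (by rwa [TangentBundle.mem_chart_source_iff])

theorem contDiffOn_coordFun {f : TB E Q → ℝ}
    (hf : ContMDiff 𝓘(ℝ, E).tangent 𝓘(ℝ, ℝ) n f) (q₀ : Q) :
    ContDiffOn ℝ n (coordFun q₀ f) ((chartAt E q₀).target ×ˢ Set.univ) := by
  rw [← contMDiffOn_iff_contDiffOn]
  exact hf.comp_contMDiffOn (contMDiffOn_tangentChart_symm q₀)

theorem contMDiff_of_coordFun {f : TB E Q → ℝ}
    (hf : ∀ q₀, ContDiffOn ℝ n (coordFun q₀ f) ((chartAt E q₀).target ×ˢ Set.univ)) :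
    ContMDiff 𝓘(ℝ, E).tangent 𝓘(ℝ, ℝ) n f := by
  intro V
  have hV := mem_chart_source E V.proj
  have h := ((hf V.proj).contDiffAt (((chartAt E V.proj).open_target.prod isOpen_univ).mem_nhds
    ⟨tangentChart_fst_mem hV, Set.mem_univ _⟩)).contMDiffAt
  refine (h.comp V (contMDiffAt_tangentChart hV)).congr_of_eventuallyEq ?_
  filter_upwards [eventually_proj_mem_source hV] with W hW
  exact (coordFun_tangentChart f hW).symm

theorem contDiffOn_coordMap {F : ∀ V : TB E Q, T E V.proj}
    (hF : ContMDiff 𝓘(ℝ, E).tangent 𝓘(ℝ, E).tangent n (fiberMap F)) (q₀ : Q) :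
    ContDiffOn ℝ n (coordMap q₀ F) ((chartAt E q₀).target ×ˢ Set.univ) := by
  have h : ContDiffOn ℝ n (tangentChart E q₀ ∘ fiberMap F ∘ (tangentChart E q₀).symm)
      ((chartAt E q₀).target ×ˢ Set.univ) := by
    rw [← contMDiffOn_iff_contDiffOn]
    intro p hp
    exact (contMDiffAt_tangentChart (V := fiberMap F ((tangentChart E q₀).symm p))
      (tangentChart_symm_proj_mem hp.1)).comp_contMDiffWithinAt p
      (hF.comp_contMDiffOn (contMDiffOn_tangentChart_symm q₀) p hp)
  refine h.snd.congr fun p hp ↦ ?_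
  exact (congrArg Prod.snd (tangentChart_apply (V := fiberMap F ((tangentChart E q₀).symm p))
    (tangentChart_symm_proj_mem hp.1))).symm

/-- The base component of a fibre preserving map is the projection, so only the fibre coordinate has
to be checked. -/
theorem contMDiff_of_coordMap {F : ∀ V : TB E Q, T E V.proj}
    (hF : ∀ q₀, ContDiffOn ℝ n (coordMap q₀ F) ((chartAt E q₀).target ×ˢ Set.univ)) :
    ContMDiff 𝓘(ℝ, E).tangent 𝓘(ℝ, E).tangent n (fiberMap F) := by
  intro V
  have hV := mem_chart_source E V.proj
  refine Bundle.contMDiffAt_totalSpace.2 ⟨Bundle.contMDiffAt_proj (T E), ?_⟩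
  have h := ((hF V.proj).contDiffAt (((chartAt E V.proj).open_target.prod isOpen_univ).mem_nhds
    ⟨tangentChart_fst_mem hV, Set.mem_univ _⟩)).contMDiffAt
  refine (h.comp V (contMDiffAt_tangentChart hV)).congr_of_eventuallyEq ?_
  filter_upwards [eventually_proj_mem_source hV] with W hW
  refine (congrArg Prod.snd (tangentChart_apply (V := fiberMap F W) hW)).trans ?_
  exact (coordMap_tangentChart F hW).symm

variable {g : WeakRiemannianMetric E Q} (C : RiemannianConnection g)

/-- Chain rule through the chart at `q₀`, with the splitting expressed by
`mfderiv_tangentChart_theta_symm`. -/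
theorem mfderiv_theta_symm {f : TB E Q → ℝ} {V : TB E Q} (hV : V.proj ∈ (chartAt E q₀).source)
    (hf : DifferentiableAt ℝ (coordFun q₀ f) (tangentChart E q₀ V)) (W W' : T E V.proj) :
    mfderiv 𝓘(ℝ, E).tangent 𝓘(ℝ, ℝ) f V ((C.theta V).symm (W, W')) =
      fderiv ℝ (coordFun q₀ f) (tangentChart E q₀ V) (toCoord E q₀ V.proj W,
        toCoord E q₀ V.proj W' - C.Γ (chartAt E q₀) (tangentChart E q₀ V).1
          (tangentChart E q₀ V).2 (toCoord E q₀ V.proj W)) := by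
  have h1 := (hasMFDerivAt_tangentChart hV).mdifferentiableAt.hasMFDerivAt
  have h2 : HasMFDerivAt 𝓘(ℝ, E).tangent 𝓘(ℝ, ℝ) f V _ :=
    (hf.hasFDerivAt.hasMFDerivAt.comp V h1).congr_of_eventuallyEq (by
      filter_upwards [eventually_proj_mem_source hV] with W hW
      exact (coordFun_tangentChart f hW).symm)
  rw [h2.mfderiv]
  exact congrArg (fderiv ℝ (coordFun q₀ f) (tangentChart E q₀ V))
    (C.mfderiv_tangentChart_theta_symm hV W W')

/-- Functions with covariant partial derivatives represented by vectors, in coordinates. -/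
theorem isCoordGrad_coordFun {f : TB E Q → ℝ}
    (hf : DifferentiableOn ℝ (coordFun q₀ f) ((chartAt E q₀).target ×ˢ Set.univ))
    (hA : ∀ V, g.Represents (C.gradBase f V) (C.dBase f V))
    (hB : ∀ V, g.Represents (C.gradFiber f V) (C.dFiber f V)) :
    IsCoordGrad (chartAt E q₀).target (g.coord q₀) (C.Γ (chartAt E q₀)) (coordFun q₀ f)
      (coordMap q₀ (C.gradBase f)) (coordMap q₀ (C.gradFiber f)) := by
  intro p hp a w
  obtain ⟨V, hV, rfl⟩ : ∃ V : TB E Q, V.proj ∈ (chartAt E q₀).source ∧ tangentChart E q₀ V = p :=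
    ⟨(tangentChart E q₀).symm p, tangentChart_symm_proj_mem hp,
      (tangentChart E q₀).right_inv (mem_tangentChart_target.2 hp)⟩
  have hfV := hf.differentiableAt (((chartAt E q₀).open_target.prod isOpen_univ).mem_nhds
    ⟨hp, Set.mem_univ (tangentChart E q₀ V).2⟩)
  rw [coordMap_tangentChart _ hV, coordMap_tangentChart _ hV]
  -- The vertical part of the coordinate vector `(a, w)`.
  set w' : E := w + C.Γ (chartAt E q₀) (tangentChart E q₀ V).1 (tangentChart E q₀ V).2 a with hw'
  have ha := hA V (ofCoord E q₀ V.proj a)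
  have hb := hB V (ofCoord E q₀ V.proj w')
  have ha' : C.dBase f V (ofCoord E q₀ V.proj a) = _ :=
    mfderiv_theta_symm C hV hfV (ofCoord E q₀ V.proj a) 0
  have hb' : C.dFiber f V (ofCoord E q₀ V.proj w') = _ :=
    mfderiv_theta_symm C hV hfV 0 (ofCoord E q₀ V.proj w')
  rw [toCoord_ofCoord hV, map_zero, ha, ← g.coord_toCoord hV, toCoord_ofCoord hV] at ha'
  rw [toCoord_ofCoord hV, map_zero, hb, ← g.coord_toCoord hV, toCoord_ofCoord hV] at hb'
  have hfst : (tangentChart E q₀ V).1 = chartAt E q₀ V.proj := by rw [tangentChart_apply hV]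
  rw [hfst] at *
  rw [ha', hb', ← map_add]
  congr 1
  simp [hw']

/-- A function whose covariant partial derivatives are represented by vectors in coordinates. -/
theorem represents_of_coord {f : TB E Q → ℝ} {V : TB E Q} (hV : V.proj ∈ (chartAt E q₀).source)
    (hf : DifferentiableAt ℝ (coordFun q₀ f) (tangentChart E q₀ V)) {a b : E}
    (hab : ∀ c z, fderiv ℝ (coordFun q₀ f) (tangentChart E q₀ V)
      (c, z - C.Γ (chartAt E q₀) (tangentChart E q₀ V).1 (tangentChart E q₀ V).2 c) =
        g.coord q₀ (tangentChart E q₀ V).1 a c + g.coord q₀ (tangentChart E q₀ V).1 b z) :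
    g.Represents (ofCoord E q₀ V.proj a) (C.dBase f V) ∧
      g.Represents (ofCoord E q₀ V.proj b) (C.dFiber f V) := by
  have hfst : (tangentChart E q₀ V).1 = chartAt E q₀ V.proj := by rw [tangentChart_apply hV]
  constructor
  · intro X
    refine (mfderiv_theta_symm C hV hf X 0).trans ?_
    rw [map_zero, hab, hfst, map_zero, add_zero, ← g.coord_toCoord hV, toCoord_ofCoord hV]
  · intro X
    refine (mfderiv_theta_symm C hV hf 0 X).trans ?_
    rw [map_zero, hab, hfst, map_zero, zero_add, ← g.coord_toCoord hV, toCoord_ofCoord hV]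

/-- `V` and its image lie over the same point, so a single chart of `TQ` gives the coordinates on
both tangent spaces. -/
theorem mfderiv_fiberMap {F : ∀ V : TB E Q, T E V.proj} {V : TB E Q}
    (hF : ContMDiff 𝓘(ℝ, E).tangent 𝓘(ℝ, E).tangent 1 (fiberMap F)) (u w : E) :
    (mfderiv 𝓘(ℝ, E).tangent 𝓘(ℝ, E).tangent (fiberMap F) V : E × E →L[ℝ] E × E) (u, w) =
      (u, fderiv ℝ (coordMap V.proj F) (tangentChart E V.proj V) (u, w)) := by
  have hV := mem_chart_source E V.proj
  have hmem := ((chartAt E V.proj).open_target.prod (isOpen_univ (X := E))).mem_nhds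
    (x := tangentChart E V.proj V) ⟨tangentChart_fst_mem hV, Set.mem_univ _⟩
  have hd := (((contDiffOn_coordMap (n := 1) hF V.proj).contDiffAt hmem).differentiableAt
    (by simp)).hasFDerivAt
  have h := (hF V).mdifferentiableAt (by simp)
  rw [h.mfderiv]
  have h1 : HasFDerivAt (writtenInExtChartAt 𝓘(ℝ, E).tangent 𝓘(ℝ, E).tangent V (fiberMap F)) _
      (tangentChart E V.proj V) :=
    ((hasFDerivAt_fst (𝕜 := ℝ)).prodMk hd).congr_of_eventuallyEq (by
      filter_upwards [hmem] with p hp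
      refine (tangentChart_apply (V := fiberMap F ((tangentChart E V.proj).symm p))
        (tangentChart_symm_proj_mem hp.1)).trans ?_
      exact Prod.ext ((chartAt E V.proj).right_inv hp.1) rfl)
  rw [ModelWithCorners.range_eq_univ, fderivWithin_univ]
  exact congrArg (fun l : E × E →L[ℝ] E × E ↦ l (u, w)) h1.fderiv

theorem tangentChart_self (V : TB E Q) :
    tangentChart E V.proj V = (chartAt E V.proj V.proj, V.snd) := by
  rw [tangentChart_apply (mem_chart_source E V.proj), toCoord_self]
  rfl

theorem connector_mfderiv_fiberMap {F : ∀ V : TB E Q, T E V.proj} {V : TB E Q}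
    (hF : ContMDiff 𝓘(ℝ, E).tangent 𝓘(ℝ, E).tangent 1 (fiberMap F)) (W W' : T E V.proj) :
    C.connector (fiberMap F V) (mfderiv 𝓘(ℝ, E).tangent 𝓘(ℝ, E).tangent (fiberMap F) V
      ((C.theta V).symm (W, W'))) =
      coordCov (C.Γ (chartAt E V.proj)) (coordMap V.proj F) (tangentChart E V.proj V) W W' := by
  have hF0 : coordMap V.proj F (tangentChart E V.proj V) = F V := by
    rw [coordMap_tangentChart _ (mem_chart_source E V.proj), toCoord_self]
  change E at W W'
  have h := mfderiv_fiberMap (V := V) hF W (W' - C.christoffel V.proj V.snd W)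
  refine (congrArg (C.connector (fiberMap F V)) h).trans ?_
  rw [coordCov, hF0, tangentChart_self]
  rfl

end Functions

/-! ### Regularity and covariant partials of the bracket -/

section Bracket

variable {E : Type*} [NormedAddCommGroup E] [NormedSpace ℝ E]

theorem contDiffOn_coordCov {U : Set E} (hU : IsOpen U) {Γ : E → E →L[ℝ] E →L[ℝ] E}
    (hΓ : ContDiffOn ℝ ∞ Γ U) {n : ℕ∞} {F X Y : E × E → E}
    (hF : ContDiffOn ℝ (n + 1 : ℕ∞) F (U ×ˢ Set.univ))
    (hX : ContDiffOn ℝ n X (U ×ˢ Set.univ)) (hY : ContDiffOn ℝ n Y (U ×ˢ Set.univ)) :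
    ContDiffOn ℝ n (fun p ↦ coordCov Γ F p (X p) (Y p)) (U ×ˢ Set.univ) := by
  have hF' : ContDiffOn ℝ n (fderiv ℝ F) (U ×ˢ Set.univ) :=
    hF.fderiv_of_isOpen (hU.prod isOpen_univ) (by push_cast; exact le_rfl)
  have hΓ' : ContDiffOn ℝ n (fun p : E × E ↦ Γ p.1) (U ×ˢ Set.univ) :=
    (hΓ.of_le (by exact mod_cast le_top)).comp contDiff_fst.contDiffOn fun p hp ↦ hp.1
  exact (hF'.clm_apply (hX.prodMk (hY.sub
    ((hΓ'.clm_apply contDiff_snd.contDiffOn).clm_apply hX)))).add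
    ((hΓ'.clm_apply (hF.of_le (by exact mod_cast le_self_add))).clm_apply hX)

theorem contDiffOn_coordCurvature {U : Set E} (hU : IsOpen U) {Γ : E → E →L[ℝ] E →L[ℝ] E}
    (hΓ : ContDiffOn ℝ ∞ Γ U) {n : ℕ∞} {X Y Z : E × E → E}
    (hX : ContDiffOn ℝ n X (U ×ˢ Set.univ)) (hY : ContDiffOn ℝ n Y (U ×ˢ Set.univ))
    (hZ : ContDiffOn ℝ n Z (U ×ˢ Set.univ)) :
    ContDiffOn ℝ n (fun p ↦ coordCurvature Γ p.1 (X p) (Y p) (Z p)) (U ×ˢ Set.univ) := by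
  have hΓ' : ContDiffOn ℝ n (fun p : E × E ↦ Γ p.1) (U ×ˢ Set.univ) :=
    (hΓ.of_le (by exact mod_cast le_top)).comp contDiff_fst.contDiffOn fun p hp ↦ hp.1
  have hD : ContDiffOn ℝ n (fun p : E × E ↦ fderiv ℝ Γ p.1) (U ×ˢ Set.univ) :=
    (hΓ.fderiv_of_isOpen hU (by exact mod_cast le_top)).comp
      contDiff_fst.contDiffOn fun p hp ↦ hp.1
  exact ((((hD.clm_apply hY).clm_apply hZ).clm_apply hX).sub
    (((hD.clm_apply hX).clm_apply hZ).clm_apply hY)).add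
    ((hΓ'.clm_apply ((hΓ'.clm_apply hZ).clm_apply hX)).clm_apply hY) |>.sub
    ((hΓ'.clm_apply ((hΓ'.clm_apply hZ).clm_apply hY)).clm_apply hX)

variable {Q : Type*} [TopologicalSpace Q] [ChartedSpace E Q] [IsManifold 𝓘(ℝ, E) ∞ Q]
variable {g : WeakRiemannianMetric E Q} (C : RiemannianConnection g)

theorem classK_anti {k l : ℕ∞} (hkl : k ≤ l) : C.classK l ⊆ C.classK k := by
  rintro f ⟨h0, h1, h2, h3, h4⟩
  exact ⟨h0.of_le (by exact mod_cast add_le_add_left hkl 1), h1, h2,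
    h3.of_le (by exact mod_cast hkl), h4.of_le (by exact mod_cast hkl)⟩

/-- The covariant partial derivative of the bracket along the base, in coordinates. -/
def coordBracketBase (q₀ : Q) (f h : TB E Q → ℝ) (p : E × E) : E :=
  let cov := fun F ↦ coordCov (C.Γ (chartAt E q₀)) (coordMap q₀ F) p
  let vec := fun F ↦ coordMap q₀ F p
  cov (C.gradBase f) (vec (C.gradFiber h)) 0 + cov (C.gradBase h) 0 (vec (C.gradBase f)) -
    cov (C.gradBase h) (vec (C.gradFiber f)) 0 - cov (C.gradBase f) 0 (vec (C.gradBase h)) +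
    coordCurvature (C.Γ (chartAt E q₀)) p.1 (vec (C.gradFiber f)) (vec (C.gradFiber h)) p.2

/-- The covariant partial derivative of the bracket along the fibre, in coordinates. -/
def coordBracketFiber (q₀ : Q) (f h : TB E Q → ℝ) (p : E × E) : E :=
  let cov := fun F ↦ coordCov (C.Γ (chartAt E q₀)) (coordMap q₀ F) p
  let vec := fun F ↦ coordMap q₀ F p
  cov (C.gradFiber f) (vec (C.gradFiber h)) 0 + cov (C.gradFiber h) 0 (vec (C.gradBase f)) -
    cov (C.gradFiber h) (vec (C.gradFiber f)) 0 - cov (C.gradFiber f) 0 (vec (C.gradBase h))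

theorem coordFun_bracket (q₀ : Q) (f h : TB E Q → ℝ) {p : E × E}
    (hp : p.1 ∈ (chartAt E q₀).target) :
    coordFun q₀ (C.bracket f h) p =
      g.coord q₀ p.1 (coordMap q₀ (C.gradBase f) p) (coordMap q₀ (C.gradFiber h) p) -
        g.coord q₀ p.1 (coordMap q₀ (C.gradFiber f) p) (coordMap q₀ (C.gradBase h) p) := by
  have hq := tangentChart_symm_proj_mem hp
  have h1 : p.1 = chartAt E q₀ ((tangentChart E q₀).symm p).proj :=
    ((chartAt E q₀).right_inv hp).symm
  rw [h1]
  simp only [coordMap]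
  rw [g.coord_toCoord hq, g.coord_toCoord hq]
  rfl

variable {C} {n : ℕ∞} {f h : TB E Q → ℝ}

/-- The bracket itself involves no derivative of the partials. Hence for arguments in `𝒦^{n+1}` it
is of class `C^{n+1}`, which is what `𝒦^n` requires. -/
theorem contDiffOn_coordFun_bracket (hf : f ∈ C.classK n) (hh : h ∈ C.classK n) (q₀ : Q) :
    ContDiffOn ℝ n (coordFun q₀ (C.bracket f h)) ((chartAt E q₀).target ×ˢ Set.univ) := by
  have hG : ContDiffOn ℝ n (fun p : E × E ↦ g.coord q₀ p.1) ((chartAt E q₀).target ×ˢ Set.univ) :=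
    ((g.contDiffOn_coord q₀).of_le (by exact mod_cast le_top)).comp contDiff_fst.contDiffOn
      fun p hp ↦ hp.1
  refine ContDiffOn.congr ?_ fun p hp ↦ coordFun_bracket C q₀ f h hp.1
  exact ((hG.clm_apply (contDiffOn_coordMap hf.2.2.2.1 q₀)).clm_apply
    (contDiffOn_coordMap hh.2.2.2.2 q₀)).sub
    ((hG.clm_apply (contDiffOn_coordMap hf.2.2.2.2 q₀)).clm_apply
    (contDiffOn_coordMap hh.2.2.2.1 q₀))

/-- Representability comes from exhibiting the vectors. An arbitrary chart around `V` is allowed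
because regularity needs the formula on a whole chart domain. -/
theorem represents_bracket (hf : f ∈ C.classK 1) (hh : h ∈ C.classK 1) {q₀ : Q} {V : TB E Q}
    (hV : V.proj ∈ (chartAt E q₀).source) :
    g.Represents (ofCoord E q₀ V.proj (coordBracketBase C q₀ f h (tangentChart E q₀ V)))
        (C.dBase (C.bracket f h) V) ∧
      g.Represents (ofCoord E q₀ V.proj (coordBracketFiber C q₀ f h (tangentChart E q₀ V)))
        (C.dFiber (C.bracket f h) V) := by
  have hp := tangentChart_fst_mem hV
  have hopen := (chartAt E q₀).open_target.prod (isOpen_univ (X := E))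
  have hnhds := hopen.mem_nhds (x := tangentChart E q₀ V) ⟨hp, Set.mem_univ _⟩
  have h2 : ∀ {f : TB E Q → ℝ}, f ∈ C.classK 1 →
      ContDiffOn ℝ 2 (coordFun q₀ f) ((chartAt E q₀).target ×ˢ Set.univ) := fun hf ↦
    (contDiffOn_coordFun hf.1 q₀).of_le (by norm_num)
  have hgrad : ∀ {f : TB E Q → ℝ}, f ∈ C.classK 1 →
      IsCoordGrad (chartAt E q₀).target (g.coord q₀) (C.Γ (chartAt E q₀)) (coordFun q₀ f)
        (coordMap q₀ (C.gradBase f)) (coordMap q₀ (C.gradFiber f)) := fun hf ↦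
    isCoordGrad_coordFun C ((h2 hf).differentiableOn (by simp)) hf.2.1 hf.2.2.1
  have hdiff : ∀ {F : ∀ V : TB E Q, T E V.proj},
      ContMDiff 𝓘(ℝ, E).tangent 𝓘(ℝ, E).tangent ((1 : ℕ∞) : WithTop ℕ∞) (fiberMap F) →
      DifferentiableAt ℝ (coordMap q₀ F) (tangentChart E q₀ V) := fun hF ↦
    ((contDiffOn_coordMap hF q₀).contDiffAt hnhds).differentiableAt (by simp)
  refine represents_of_coord C hV (((contDiffOn_coordFun_bracket hf hh q₀).contDiffAt
    hnhds).differentiableAt (by simp)) fun c z ↦ ?_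
  rw [Filter.EventuallyEq.fderiv_eq (by
    filter_upwards [hnhds] with p hp using coordFun_bracket C q₀ f h hp.1)]
  exact (C.isRiemannianOn q₀).fderiv_bracket (hgrad hf) (hgrad hh) hp
    ((h2 hf).contDiffAt hnhds) ((h2 hh).contDiffAt hnhds) (hdiff hf.2.2.2.1)
    (hdiff hf.2.2.2.2) (hdiff hh.2.2.2.1) (hdiff hh.2.2.2.2) c z

theorem gradBase_bracket_eq_ofCoord (hf : f ∈ C.classK 1) (hh : h ∈ C.classK 1) {q₀ : Q}
    {V : TB E Q} (hV : V.proj ∈ (chartAt E q₀).source) :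
    C.gradBase (C.bracket f h) V =
      ofCoord E q₀ V.proj (coordBracketBase C q₀ f h (tangentChart E q₀ V)) :=
  g.sharp_eq (represents_bracket hf hh hV).1

theorem gradFiber_bracket_eq_ofCoord (hf : f ∈ C.classK 1) (hh : h ∈ C.classK 1) {q₀ : Q}
    {V : TB E Q} (hV : V.proj ∈ (chartAt E q₀).source) :
    C.gradFiber (C.bracket f h) V =
      ofCoord E q₀ V.proj (coordBracketFiber C q₀ f h (tangentChart E q₀ V)) :=
  g.sharp_eq (represents_bracket hf hh hV).2

theorem coordMap_eq_of_eq_ofCoord {F : ∀ V : TB E Q, T E V.proj} {q₀ : Q} {Φ : E × E → E}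
    (hF : ∀ V : TB E Q, V.proj ∈ (chartAt E q₀).source →
      F V = ofCoord E q₀ V.proj (Φ (tangentChart E q₀ V)))
    {p : E × E} (hp : p.1 ∈ (chartAt E q₀).target) : coordMap q₀ F p = Φ p := by
  have hq := tangentChart_symm_proj_mem hp
  rw [coordMap, hF _ hq, toCoord_ofCoord hq,
    (tangentChart E q₀).right_inv (mem_tangentChart_target.2 hp)]

/-- The bracket of two functions of class `𝒦^{n + 1}` is of class `𝒦^n`. -/
theorem bracket_mem_classK (hf : f ∈ C.classK (n + 1)) (hh : h ∈ C.classK (n + 1)) :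
    C.bracket f h ∈ C.classK n := by
  have hf1 : f ∈ C.classK 1 := classK_anti C le_add_self hf
  have hh1 : h ∈ C.classK 1 := classK_anti C le_add_self hh
  have hfn : f ∈ C.classK n := classK_anti C le_self_add hf
  have hhn : h ∈ C.classK n := classK_anti C le_self_add hh
  refine ⟨contMDiff_of_coordFun fun q₀ ↦ contDiffOn_coordFun_bracket hf hh q₀, fun V ↦ ?_,
    fun V ↦ ?_, contMDiff_of_coordMap fun q₀ ↦ ?_, contMDiff_of_coordMap fun q₀ ↦ ?_⟩
  · rw [gradBase_bracket_eq_ofCoord hf1 hh1 (mem_chart_source E V.proj)]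
    exact (represents_bracket hf1 hh1 (mem_chart_source E V.proj)).1
  · rw [gradFiber_bracket_eq_ofCoord hf1 hh1 (mem_chart_source E V.proj)]
    exact (represents_bracket hf1 hh1 (mem_chart_source E V.proj)).2
  all_goals
    have hU := (chartAt E q₀).open_target
    have hΓ := C.smooth _ (chart_mem_atlas E q₀)
    -- The unprimed maps are of class `C^{n+1}` and get differentiated; the primed ones, of class
    -- `C^n`, serve as directions.
    have hfA := contDiffOn_coordMap hf.2.2.2.1 q₀
    have hfB := contDiffOn_coordMap hf.2.2.2.2 q₀
    have hhA := contDiffOn_coordMap hh.2.2.2.1 q₀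
    have hhB := contDiffOn_coordMap hh.2.2.2.2 q₀
    have hfA' := contDiffOn_coordMap hfn.2.2.2.1 q₀
    have hfB' := contDiffOn_coordMap hfn.2.2.2.2 q₀
    have hhA' := contDiffOn_coordMap hhn.2.2.2.1 q₀
    have hhB' := contDiffOn_coordMap hhn.2.2.2.2 q₀
    have h0 : ContDiffOn ℝ n (fun _ : E × E ↦ (0 : E)) ((chartAt E q₀).target ×ˢ Set.univ) :=
      contDiffOn_const
  · refine ContDiffOn.congr ?_ fun p hp ↦ coordMap_eq_of_eq_ofCoord
      (fun V hV ↦ gradBase_bracket_eq_ofCoord hf1 hh1 hV) hp.1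
    exact ((((contDiffOn_coordCov hU hΓ hfA hhB' h0).add
      (contDiffOn_coordCov hU hΓ hhA h0 hfA')).sub
      (contDiffOn_coordCov hU hΓ hhA hfB' h0)).sub
      (contDiffOn_coordCov hU hΓ hfA h0 hhA')).add
      (contDiffOn_coordCurvature hU hΓ hfB' hhB' contDiff_snd.contDiffOn)
  · refine ContDiffOn.congr ?_ fun p hp ↦ coordMap_eq_of_eq_ofCoord
      (fun V hV ↦ gradFiber_bracket_eq_ofCoord hf1 hh1 hV) hp.1
    exact (((contDiffOn_coordCov hU hΓ hfB hhB' h0).add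
      (contDiffOn_coordCov hU hΓ hhB h0 hfA')).sub
      (contDiffOn_coordCov hU hΓ hhB hfB' h0)).sub
      (contDiffOn_coordCov hU hΓ hfB h0 hhA')

theorem covBase_eq_coordCov {F : ∀ V : TB E Q, T E V.proj}
    (hF : ContMDiff 𝓘(ℝ, E).tangent 𝓘(ℝ, E).tangent 1 (fiberMap F)) (V : TB E Q)
    (W : T E V.proj) :
    C.covBase F V W =
      coordCov (C.Γ (chartAt E V.proj)) (coordMap V.proj F) (tangentChart E V.proj V) W 0 :=
  connector_mfderiv_fiberMap C hF W 0

theorem covFiber_eq_coordCov {F : ∀ V : TB E Q, T E V.proj}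
    (hF : ContMDiff 𝓘(ℝ, E).tangent 𝓘(ℝ, E).tangent 1 (fiberMap F)) (V : TB E Q)
    (W : T E V.proj) :
    C.covFiber F V W =
      coordCov (C.Γ (chartAt E V.proj)) (coordMap V.proj F) (tangentChart E V.proj V) 0 W :=
  connector_mfderiv_fiberMap C hF 0 W

theorem coordMap_self (F : ∀ V : TB E Q, T E V.proj) (V : TB E Q) :
    coordMap V.proj F (tangentChart E V.proj V) = F V := by
  rw [coordMap_tangentChart _ (mem_chart_source E V.proj), toCoord_self]

theorem gradBase_bracket (hf : f ∈ C.classK 1) (hh : h ∈ C.classK 1) (V : TB E Q) :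
    C.gradBase (C.bracket f h) V =
      C.covBase (C.gradBase f) V (C.gradFiber h V) + C.covFiber (C.gradBase h) V (C.gradBase f V)
        - C.covBase (C.gradBase h) V (C.gradFiber f V)
        - C.covFiber (C.gradBase f) V (C.gradBase h V)
        + C.curvature V.proj (C.gradFiber f V) (C.gradFiber h V) V.snd := by
  -- In the preferred chart at `V.proj` the coordinate identification of the tangent space is the
  -- identity.
  rw [gradBase_bracket_eq_ofCoord hf hh (mem_chart_source E V.proj), ofCoord_self,
    covBase_eq_coordCov hf.2.2.2.1, covFiber_eq_coordCov hf.2.2.2.1,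
    covBase_eq_coordCov hh.2.2.2.1, covFiber_eq_coordCov hh.2.2.2.1]
  simp only [coordBracketBase, coordMap_self]
  rw [tangentChart_self]
  rfl

theorem gradFiber_bracket (hf : f ∈ C.classK 1) (hh : h ∈ C.classK 1) (V : TB E Q) :
    C.gradFiber (C.bracket f h) V =
      C.covBase (C.gradFiber f) V (C.gradFiber h V)
        + C.covFiber (C.gradFiber h) V (C.gradBase f V)
        - C.covBase (C.gradFiber h) V (C.gradFiber f V)
        - C.covFiber (C.gradFiber f) V (C.gradBase h V) := by
  rw [gradFiber_bracket_eq_ofCoord hf hh (mem_chart_source E V.proj), ofCoord_self,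
    covBase_eq_coordCov hf.2.2.2.2, covFiber_eq_coordCov hf.2.2.2.2,
    covBase_eq_coordCov hh.2.2.2.2, covFiber_eq_coordCov hh.2.2.2.2]
  simp only [coordBracketFiber, coordMap_self]
  rfl

end Bracket

end WeakPoisson

end

theorem mainTheorem8 {E : Type*} [NormedAddCommGroup E] [NormedSpace ℝ E] [CompleteSpace E]
    {Q : Type*} [TopologicalSpace Q] [ChartedSpace E Q] [IsManifold 𝓘(ℝ, E) ∞ Q]
    (g : WeakPoisson.WeakRiemannianMetric E Q) (C : WeakPoisson.RiemannianConnection g)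
    (hdense : g.DenseInclusion) :
    -- `{𝒦^k, 𝒦^m} ⊆ 𝒦^{min(k, m) - 1}`
    (∀ k m : ℕ, 1 ≤ k → 1 ≤ m → ∀ f ∈ C.classK (k : ℕ∞), ∀ h ∈ C.classK (m : ℕ∞),
      C.bracket f h ∈ C.classK ((min k m - 1 : ℕ) : ℕ∞)) ∧
    -- `{𝒦, 𝒦} ⊆ 𝒦`
    (∀ f ∈ C.classK ⊤, ∀ h ∈ C.classK ⊤, C.bracket f h ∈ C.classK ⊤) ∧
    -- the covariant partials of the bracket
    (∀ f ∈ C.classK 1, ∀ h ∈ C.classK 1, ∀ V : WeakPoisson.TB E Q,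
      C.gradBase (C.bracket f h) V =
          C.covBase (C.gradBase f) V (C.gradFiber h V)
            + C.covFiber (C.gradBase h) V (C.gradBase f V)
            - C.covBase (C.gradBase h) V (C.gradFiber f V)
            - C.covFiber (C.gradBase f) V (C.gradBase h V)
            + C.curvature V.proj (C.gradFiber f V) (C.gradFiber h V) V.snd ∧
      C.gradFiber (C.bracket f h) V =
          C.covBase (C.gradFiber f) V (C.gradFiber h V)
            + C.covFiber (C.gradFiber h) V (C.gradBase f V)
            - C.covBase (C.gradFiber h) V (C.gradFiber f V)
            - C.covFiber (C.gradFiber f) V (C.gradBase h V)) := by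
  refine ⟨fun k m hk hm f hf h hh ↦ ?_, fun f hf h hh ↦ ?_, fun f hf h hh V ↦
    ⟨WeakPoisson.gradBase_bracket hf hh V, WeakPoisson.gradFiber_bracket hf hh V⟩⟩
  -- The truncated subtraction is genuine because `k` and `m` are at least one.
  · have hn : ((min k m - 1 : ℕ) : ℕ∞) + 1 = ((min k m : ℕ) : ℕ∞) := by
      exact_mod_cast Nat.sub_add_cancel (le_min hk hm)
    refine WeakPoisson.bracket_mem_classK ?_ ?_ <;> rw [hn]
    · exact WeakPoisson.classK_anti C (by exact_mod_cast min_le_left k m) hf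
    · exact WeakPoisson.classK_anti C (by exact_mod_cast min_le_right k m) hh
  -- The case `n = ⊤`, since `⊤ + 1 = ⊤`.
  · exact WeakPoisson.bracket_mem_classK (by simpa using hf) (by simpa using hh)
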